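/- Let $X,Y,W$ be real Banach spaces with $W\neq\{0\}$, with topological duals $X^*,Y^*$, closed unit balls $B_X$, etc., and unit spheres $S_X$, etc. Equip $X\times Y^*$ with the norm $\|(x,y^*)\|=\|x\|+\|y^*\|$. For $p\in X\times Y^*$ put $\Gamma(p)=\{p,-p\}$, and let $d_H$ be the Hausdorff distance, so that $d_H(\Gamma(p),\Gamma(q))=\min(\|p-q\|,\|p+q\|)$. Let $L$ be a nonempty, symmetric ($-L=L$), closed subset of $S_X\times S_{Y^*}$ with property $(P)$: for every sufficiently small $\varepsilon>0$ there is $\varpi(\varepsilon)>0$ such that for every $(x,y^*)\in L$ there is $(x^*_\varepsilon,y_\varepsilon)\in B_{X^*}\times B_Y$ with, for all $(z,t^*)\in L$, $$d_H(\Gamma(x,y^*),\Gamma(z,t^*))\ge\varepsilon\ \Longrightarrow\ x^*_\varepsilon(x)+y^*(y_\varepsilon)-\varpi(\varepsilon)\ \ge\ |x^*_\varepsilon(z)|+|t^*(y_\varepsilon)|.$$ Let $C_{b,e}(L,W)$ be the space of bounded continuous maps $\Phi:L\to W$ with $\Phi(-p)=\Phi(p)$ for all $p\in L$, with the sup-norm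 $\|\cdot\|_\infty$. Say that $\Phi\in C_{b,e}(L,W)$ attains $d_H$-strongly its maximum on $L$ if there is $p_0\in L$ such that $\|\Phi(p_0)\|=\sup_{p\in L}\|\Phi(p)\|$ and such that $d_H(\Gamma(p_n),\Gamma(p_0))\to0$ for every sequence $(p_n)$ in $L$ with $\|\Phi(p_n)\|\to\sup_{p\in L}\|\Phi(p)\|$. Let $\mathcal Z$ be a linear subspace of $C_{b,e}(L,W)$ that is a Banach space under a norm $\|\cdot\|_{\mathcal Z}$ such that: (i) $\|\Phi\|_{\mathcal Z}\ge\|\Phi\|_\infty$ for all $\Phi\in\mathcal Z$; (ii) for every bounded finite rank linear operator $T:X\to Y$ and every $w\in W$, the map $[T]\oplus w:L\to W$, $(x,y^*)\mapsto y^*(Tx)\,w$, belongs to $\mathcal Z$ and $\|[T]\oplus w\|_{\mathcal Z}\le\|T\|\,\|w\|$. A subset $A$ of a metric space $M$ is porous if there are $\lambda_0\in(0,1]$ and $r_0>0$ such that for all $x\in M$ and $r\in(0,r_0]$ there is $y\in M$ such that the open ball $B(y,\lambda_0r)$ is contained in $B(x,r)\cap(M\setminus A)$; it is $\sigma$-porous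 if it is a countable union of porous sets. Then: (1) for every $\Theta\in C_{b,e}(L,W)$ the set $$\mathcal G(\Theta)=\{\Phi\in\mathcal Z:\ \Theta+\Phi\text{ attains }d_H\text{-strongly its maximum on }L\}$$ is the complement of a $\sigma$-porous subset of $(\mathcal Z,\|\cdot\|_{\mathcal Z})$; (2) for every $\varepsilon>0$ there is $\eta(\varepsilon)>0$ such that whenever $\Phi\in\mathcal Z$ with $\|\Phi\|_\infty=1$ and $(x,y^*)\in L$ satisfy $\|\Phi(x,y^*)\|>1-\eta(\varepsilon)$, there are $\Psi\in\mathcal Z$ with $\|\Psi\|_\infty=1$ and $(z,t^*)\in L$ such that $$\|\Psi(z,t^*)\|=1,\qquad \|x-z\|+\|y^*-t^*\|<\varepsilon\qquad\text{and}\qquad \|\Psi-\Phi\|_\infty<\varepsilon.$$ -/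

import Mathlib

open Filter Topology Set
open scoped BoundedContinuousFunction

/-- Porous subsets of a metric space: one ratio `c` and one radius `r₀` serve all points. -/
def IsPorousIn {M : Type*} [PseudoMetricSpace M] (A : Set M) : Prop :=
  ∃ c : ℝ, 0 < c ∧ c ≤ 1 ∧ ∃ r₀ : ℝ, 0 < r₀ ∧
    ∀ x : M, ∀ r : ℝ, 0 < r → r ≤ r₀ →
      ∃ y : M, Metric.ball y (c * r) ⊆ Metric.ball x r ∩ Aᶜ

/-- Countable unions of porous sets. -/
def IsSigmaPorousIn {M : Type*} [PseudoMetricSpace M] (A : Set M) : Prop :=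
  ∃ P : ℕ → Set M, (∀ n, IsPorousIn (P n)) ∧ A = ⋃ n, P n

/-- The class `{x, -x}` of `x` modulo sign. -/
def signClass {V : Type*} [NormedAddCommGroup V] (x : V) : Set V := {x, -x}

/-- The Hausdorff distance between the sign classes of `x` and `y`. -/
noncomputable def signDist {V : Type*} [NormedAddCommGroup V] (x y : V) : ℝ :=
  Metric.hausdorffDist (signClass x) (signClass y)

/-- The space of bounded continuous even maps `L → W`, with the supremum norm.
Evenness is `Φ (-x) = Φ x`, written for pairs of points of `L` that are opposite in `V`. -/
def EvenBCF {V : Type*} [NormedAddCommGroup V] (L : Set V)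
    (W : Type*) [NormedAddCommGroup W] [NormedSpace ℝ W] : Submodule ℝ (L →ᵇ W) where
  carrier := {Φ | ∀ x y : L, (y : V) = -(x : V) → Φ y = Φ x}
  add_mem' := by
    intro f g hf hg x y h
    simp [hf x y h, hg x y h]
  zero_mem' := by
    intro x y _
    rfl
  smul_mem' := by
    intro c f hf x y h
    simp [hf x y h]

/-- `Φ` attains its maximum on `L` strongly for the Hausdorff distance of sign classes. -/
def AttainsStronglyModSign {V : Type*} [NormedAddCommGroup V] {L : Set V}
    {W : Type*} [NormedAddCommGroup W] [NormedSpace ℝ W] (Φ : EvenBCF L W) : Prop :=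
  ∃ x₀ : L, (⨆ x : L, ‖Φ.1 x‖) = ‖Φ.1 x₀‖ ∧
    ∀ u : ℕ → L,
      Tendsto (fun n => ‖Φ.1 (u n)‖) atTop (𝓝 (⨆ x : L, ‖Φ.1 x‖)) →
      Tendsto (fun n => signDist (u n : V) (x₀ : V)) atTop (𝓝 0)

/-- `X × Y*` with the norm `‖(x, y*)‖ = ‖x‖ + ‖y*‖`. -/
abbrev ProdDual (X Y : Type*) [NormedAddCommGroup X] [NormedSpace ℝ X]
    [NormedAddCommGroup Y] [NormedSpace ℝ Y] : Type _ :=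
  WithLp 1 (X × StrongDual ℝ Y)

/-- The property `(P)` for a subset of `X × Y*`. -/
def HasPropertyP {X Y : Type*} [NormedAddCommGroup X] [NormedSpace ℝ X]
    [NormedAddCommGroup Y] [NormedSpace ℝ Y] (L : Set (ProdDual X Y)) : Prop :=
  ∃ ε₀ : ℝ, 0 < ε₀ ∧ ∀ ε : ℝ, 0 < ε → ε < ε₀ →
    ∃ δ : ℝ, 0 < δ ∧ ∀ p ∈ L, ∃ (f : StrongDual ℝ X) (b : Y), ‖f‖ ≤ 1 ∧ ‖b‖ ≤ 1 ∧
      ∀ q ∈ L, ε ≤ signDist p q →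
        |f q.fst| + |q.snd b| ≤ f p.fst + p.snd b - δ

/-- The map `[T] ⊕ w : (x, y*) ↦ y*(T x) w`. -/
def opTensor {X Y W : Type*} [NormedAddCommGroup X] [NormedSpace ℝ X]
    [NormedAddCommGroup Y] [NormedSpace ℝ Y] [NormedAddCommGroup W] [NormedSpace ℝ W]
    (T : X →L[ℝ] Y) (w : W) : ProdDual X Y → W :=
  fun p => p.snd (T p.fst) • w

/-!
Bishop-Phelps-Bollobás argument. If `‖(Θ + Φ)(p)‖` is almost maximal, add to `Φ` a small multiple of
some `[T] ⊕ w`, where `w` is the direction of `(Θ + Φ)(p)` and `T` is a rank-two operator, supplied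
by `(P)`, for which `|y*(T x)|` peaks at `±p`. All near-maximum points then lie near `±p`, and the
same holds for every further perturbation that is small compared with the gap of the peak: the
perturbations without small slices form a porous set. A function with arbitrarily small slices
attains its maximum strongly because `L` is complete, which gives (1). By the Baire category theorem
some strongly attaining function lies arbitrarily close to the first perturbation; its maximum point
is near `±p`, and normalizing it gives (2).
-/

open Metric

section SignDist

variable {V : Type*} [NormedAddCommGroup V]

theorem self_mem_signClass (x : V) : x ∈ signClass x := Or.inl rfl

theorem signClass_neg (x : V) : signClass (-x) = signClass x := by
  rw [signClass, signClass, neg_neg, pair_comm]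

theorem hausdorffEDist_signClass_ne_top (x y : V) :
    hausdorffEDist (signClass x) (signClass y) ≠ ⊤ :=
  hausdorffEDist_ne_top_of_nonempty_of_bounded ⟨x, self_mem_signClass x⟩
    ⟨y, self_mem_signClass y⟩ (toFinite {x, -x}).isBounded (toFinite {y, -y}).isBounded

theorem signDist_nonneg (x y : V) : 0 ≤ signDist x y :=
  hausdorffDist_nonneg

theorem signDist_comm (x y : V) : signDist x y = signDist y x :=
  hausdorffDist_comm

theorem signDist_triangle (x y z : V) : signDist x z ≤ signDist x y + signDist y z :=
  hausdorffDist_triangle (hausdorffEDist_signClass_ne_top x y)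

theorem signDist_neg_right (x y : V) : signDist x (-y) = signDist x y := by
  rw [signDist, signDist, signClass_neg]

theorem signDist_le_norm_sub (x y : V) : signDist x y ≤ ‖x - y‖ := by
  refine hausdorffDist_le_of_mem_dist (norm_nonneg _) ?_ ?_
  · rintro _ (rfl | rfl)
    · exact ⟨y, Or.inl rfl, (dist_eq_norm _ _).le⟩
    · exact ⟨-y, Or.inr rfl, by rw [dist_neg_neg, dist_eq_norm]⟩
  · rintro _ (rfl | rfl)
    · exact ⟨x, Or.inl rfl, by rw [dist_comm, dist_eq_norm]⟩
    · exact ⟨-x, Or.inr rfl, by rw [dist_neg_neg, dist_comm, dist_eq_norm]⟩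

theorem signDist_eq_min (x y : V) : signDist x y = min ‖x - y‖ ‖x + y‖ := by
  apply le_antisymm
  · refine le_min (signDist_le_norm_sub x y) ?_
    simpa only [signDist_neg_right, sub_neg_eq_add] using signDist_le_norm_sub x (-y)
  · calc
      min ‖x - y‖ ‖x + y‖ ≤ infDist x (signClass y) := by
        refine (le_infDist ⟨y, self_mem_signClass y⟩).2 ?_
        rintro _ (rfl | rfl)
        · exact (min_le_left _ _).trans_eq (dist_eq_norm _ _).symm
        · exact (min_le_right _ _).trans_eq (by rw [dist_eq_norm, sub_neg_eq_add])
      _ ≤ signDist x y :=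
        infDist_le_hausdorffDist_of_mem (self_mem_signClass x)
          (hausdorffEDist_signClass_ne_top x y)

theorem signDist_lt_iff {x y : V} {c : ℝ} :
    signDist x y < c ↔ ‖x - y‖ < c ∨ ‖x + y‖ < c := by
  rw [signDist_eq_min, min_lt_iff]

end SignDist

section Porosity

variable {M : Type*} [PseudoMetricSpace M] {A : Set M}

theorem IsPorousIn.dense_interior_compl (hA : IsPorousIn A) : Dense (interior Aᶜ) := by
  obtain ⟨c, hc, -, r₀, hr₀, hball⟩ := hA
  refine dense_iff.2 fun x r hr => ?_
  have hr' : 0 < min r r₀ := lt_min hr hr₀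
  obtain ⟨y, hy⟩ := hball x (min r r₀) hr' (min_le_right _ _)
  have hy_mem : y ∈ ball y (c * min r r₀) := mem_ball_self (mul_pos hc hr')
  exact ⟨y, ball_subset_ball (min_le_left _ _) (hy hy_mem).1,
    mem_interior.2 ⟨_, hy.trans inter_subset_right, isOpen_ball, hy_mem⟩⟩

theorem IsSigmaPorousIn.dense_compl [CompleteSpace M] (hA : IsSigmaPorousIn A) : Dense Aᶜ := by
  obtain ⟨P, hP, rfl⟩ := hA
  rw [compl_iUnion]
  exact (dense_iInter_of_isOpen_nat (fun _ => isOpen_interior)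
    fun n => (hP n).dense_interior_compl).mono (iInter_mono fun _ => interior_subset)

end Porosity

section NormedSpace

variable {E : Type*} [NormedAddCommGroup E] [NormedSpace ℝ E]

theorem exists_norm_one_eq_norm_smul [Nontrivial E] (v : E) :
    ∃ w : E, ‖w‖ = 1 ∧ v = ‖v‖ • w := by
  rcases eq_or_ne v 0 with rfl | hv
  · obtain ⟨w, hw⟩ := exists_norm_eq E zero_le_one
    exact ⟨w, hw, by simp⟩
  · exact ⟨NormedSpace.normalize v, NormedSpace.norm_normalize hv,
      (NormedSpace.norm_smul_normalize v).symm⟩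

theorem norm_normalize_sub_le {x : E} (hx : ‖x‖ = 1) (y : E) :
    ‖NormedSpace.normalize y - x‖ ≤ 2 * ‖y - x‖ := by
  have hle : ‖NormedSpace.normalize y‖ ≤ 1 := by
    rw [NormedSpace.normalize, norm_smul, norm_inv, norm_norm]
    exact inv_mul_le_one
  have hy : ‖NormedSpace.normalize y - y‖ ≤ ‖y - x‖ := calc
    ‖NormedSpace.normalize y - y‖ = ‖(1 - ‖y‖) • NormedSpace.normalize y‖ := by
      rw [sub_smul, one_smul, NormedSpace.norm_smul_normalize]
    _ = |‖x‖ - ‖y‖| * ‖NormedSpace.normalize y‖ := by rw [norm_smul, Real.norm_eq_abs, hx]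
    _ ≤ |‖x‖ - ‖y‖| := mul_le_of_le_one_right (abs_nonneg _) hle
    _ ≤ ‖y - x‖ := norm_sub_rev x y ▸ abs_norm_sub_norm_le x y
  linarith [norm_sub_le_norm_sub_add_norm_sub (NormedSpace.normalize y) y x]

theorem exists_norm_le_one_lt_apply {h : StrongDual ℝ E} {r : ℝ} (hr : r < ‖h‖) :
    ∃ e : E, ‖e‖ ≤ 1 ∧ r < h e := by
  obtain ⟨e, he, hre⟩ := h.exists_lt_apply_of_lt_opNorm hr
  rcases abs_choice (h e) with habs | habs <;> rw [Real.norm_eq_abs, habs] at hre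
  · exact ⟨e, he.le, hre⟩
  · exact ⟨-e, (norm_neg e).trans_le he.le, by rwa [map_neg]⟩

theorem abs_apply_le_one {h : StrongDual ℝ E} {v : E} (hh : ‖h‖ ≤ 1) (hv : ‖v‖ ≤ 1) :
    |h v| ≤ 1 :=
  (h.unit_le_opNorm v hv).trans hh

end NormedSpace

section NearMax

variable {α : Type*} [TopologicalSpace α] {E : Type*} [SeminormedAddCommGroup E]

/-- The filter of points at which the norm of `f` is close to its supremum. -/
noncomputable def nearMax (f : α →ᵇ E) : Filter α :=
  comap (fun x => ‖f x‖) (𝓝 ‖f‖)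

theorem hasBasis_nearMax (f : α →ᵇ E) :
    (nearMax f).HasBasis (0 < ·) fun η => {x | ‖f‖ - η < ‖f x‖} := by
  refine (nhds_basis_ball.comap fun x => ‖f x‖).congr (fun _ => Iff.rfl) fun η _ => ?_
  ext x
  rw [mem_preimage, mem_ball, Real.dist_eq, abs_sub_comm,
    abs_of_nonneg (sub_nonneg.2 (f.norm_coe_le_norm x)), mem_ofPred_eq, sub_lt_comm]

instance nearMax_neBot [Nonempty α] (f : α →ᵇ E) : (nearMax f).NeBot := by
  refine (hasBasis_nearMax f).neBot_iff.2 fun {η} hη => ?_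
  have hlt : ‖f‖ - η < ⨆ x, ‖f x‖ := f.norm_eq_iSup_norm ▸ sub_lt_self ‖f‖ hη
  exact exists_lt_of_lt_ciSup hlt

theorem pure_le_nearMax {f : α →ᵇ E} {x : α} (hx : ‖f x‖ = ‖f‖) : pure x ≤ nearMax f := by
  rw [nearMax, ← map_le_iff_le_comap, map_pure, hx]
  exact pure_le_nhds _

/-- Of the margin `4σ`, one `σ` pays for the defect of `f` at `p` and two pay for the perturbation
`f'` at `p` and at `q`. -/
theorem norm_apply_le_norm_sub_of_peak {f g f' : α →ᵇ E} {p q : α} {σ : ℝ}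
    (hp : ‖f‖ - σ < ‖f p‖) (hpeak : ‖f p‖ + ‖g q‖ + 4 * σ ≤ ‖f p + g p‖)
    (hf' : ‖f' - (f + g)‖ < σ) : ‖f' q‖ ≤ ‖f'‖ - σ := by
  have hclose : ∀ x, ‖f' x - (f x + g x)‖ < σ := fun x =>
    ((f' - (f + g)).norm_coe_le_norm x).trans_lt hf'
  calc
    ‖f' q‖ ≤ ‖f q + g q‖ + ‖f' q - (f q + g q)‖ := norm_le_norm_add_norm_sub' _ _
    _ ≤ ‖f q‖ + ‖g q‖ + σ := add_le_add (norm_add_le _ _) (hclose q).le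
    _ ≤ ‖f p‖ + ‖g q‖ + 2 * σ := by linarith [f.norm_coe_le_norm q]
    _ ≤ ‖f p + g p‖ - 2 * σ := by linarith
    _ ≤ ‖f' p‖ - σ := by
      linarith [hclose p, norm_sub_norm_le (f p + g p) (f' p),
        norm_sub_rev (f p + g p) (f' p)]
    _ ≤ ‖f'‖ - σ := sub_le_sub_right (f'.norm_coe_le_norm p) σ

end NearMax

section StrongMaximum

variable {V : Type*} [NormedAddCommGroup V] {L : Set V}

/-- The slice `{q | ‖f‖ - η < ‖f q‖}` of `f` lies, for some `η > 0`, in the open `ε`-ball around a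
point of `L` for the distance modulo sign. -/
def HasSmallSlice {E : Type*} [SeminormedAddCommGroup E] (f : L →ᵇ E) (ε : ℝ) : Prop :=
  ∃ p : L, ∀ᶠ q : L in nearMax f, signDist (p : V) q < ε

theorem cauchy_of_forall_eventually_signDist_lt (U : Ultrafilter L)
    (hU : ∀ c : ℝ, 0 < c → ∃ p : L, ∀ᶠ q : L in U, signDist (p : V) q < c) :
    Cauchy (U : Filter L) := by
  have hball : ∀ c : ℝ, 0 < c → ∃ v : V, ∀ᶠ q : L in U, dist (q : V) v < c := by
    intro c hc
    obtain ⟨p, hp⟩ := hU c hc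
    simp only [signDist_lt_iff] at hp
    -- An ultrafilter chooses one of the two signs.
    rcases Ultrafilter.eventually_or.1 hp with hsub | hadd
    · exact ⟨p, hsub.mono fun q hq => by rwa [dist_comm, dist_eq_norm]⟩
    · exact ⟨-p, hadd.mono fun q hq => by rwa [dist_eq_norm, sub_neg_eq_add, add_comm]⟩
  refine Metric.cauchy_iff.2 ⟨U.neBot, fun c hc => ?_⟩
  obtain ⟨v, hv⟩ := hball (c / 2) (half_pos hc)
  refine ⟨_, hv, fun x hx y hy => ?_⟩
  calc
    dist (x : V) y ≤ dist (x : V) v + dist (y : V) v := dist_triangle_right _ _ _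
    _ < c / 2 + c / 2 := add_lt_add hx hy
    _ = c := add_halves c

variable {W : Type*} [NormedAddCommGroup W] [NormedSpace ℝ W]

theorem attainsStronglyModSign_iff {Φ : EvenBCF L W} :
    AttainsStronglyModSign Φ ↔ ∃ x : L, ‖Φ.1 x‖ = ‖Φ.1‖ ∧
      Tendsto (fun q : L => signDist (q : V) x) (nearMax Φ.1) (𝓝 0) := by
  have : (nearMax Φ.1).IsCountablyGenerated := comap.isCountablyGenerated _ _
  simp only [AttainsStronglyModSign, ← Φ.1.norm_eq_iSup_norm, eq_comm (a := ‖Φ.1‖),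
    tendsto_iff_seq_tendsto (k := nearMax Φ.1)]
  simp only [nearMax, tendsto_comap_iff, Function.comp_def]

theorem AttainsStronglyModSign.hasSmallSlice {Φ : EvenBCF L W} (hΦ : AttainsStronglyModSign Φ)
    {ε : ℝ} (hε : 0 < ε) : HasSmallSlice Φ.1 ε := by
  obtain ⟨x, -, hx⟩ := attainsStronglyModSign_iff.1 hΦ
  refine ⟨x, (hx.eventually_lt_const hε).mono fun q hq => ?_⟩
  rwa [signDist_comm]

theorem attainsStronglyModSign_of_forall_hasSmallSlice (hL_ne : L.Nonempty)
    (hL_complete : IsComplete L) {Φ : EvenBCF L W} (hΦ : ∀ ε : ℝ, 0 < ε → HasSmallSlice Φ.1 ε) :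
    AttainsStronglyModSign Φ := by
  have := hL_ne.to_subtype
  have := hL_complete.completeSpace_coe
  let U : Ultrafilter L := Ultrafilter.of (nearMax Φ.1)
  have hU_le : (U : Filter L) ≤ nearMax Φ.1 := Ultrafilter.of_le _
  have hU_cauchy : Cauchy (U : Filter L) :=
    cauchy_of_forall_eventually_signDist_lt U fun c hc =>
      (hΦ c hc).imp fun _ hp => hp.filter_mono hU_le
  obtain ⟨x, hx⟩ := CompleteSpace.complete hU_cauchy
  have hmax : ‖Φ.1 x‖ = ‖Φ.1‖ :=
    tendsto_nhds_unique ((Φ.1.continuous.norm.tendsto x).mono_left hx)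
      (tendsto_comap.mono_left hU_le)
  refine attainsStronglyModSign_iff.2 ⟨x, hmax, tendsto_order.2 ⟨fun c hc => ?_, fun c hc => ?_⟩⟩
  · exact Eventually.of_forall fun q => hc.trans_le (signDist_nonneg _ _)
  · obtain ⟨p, hp⟩ := hΦ (c / 2) (half_pos hc)
    have hpx : signDist (p : V) x < c / 2 := hp.filter_mono (pure_le_nearMax hmax)
    filter_upwards [hp] with q hpq
    rw [signDist_comm] at hpq
    linarith [signDist_triangle (q : V) p x]

end StrongMaximum

section Peaks

variable {V : Type*} [NormedAddCommGroup V] {L : Set V}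
  {W : Type*} [NormedAddCommGroup W] [NormedSpace ℝ W]
  {Z : Type*} [SeminormedAddCommGroup Z] [NormedSpace ℝ Z] {ι : Z →ₗ[ℝ] EvenBCF L W} {ε δ : ℝ}

/-- `Z` contains, for every `p ∈ L` and every direction `w`, a function of norm at most `2` that
peaks at `p` in the direction `w`, with gap `δ` outside the `ε`-neighbourhood of `±p`. The bound `2`
is the one available for sums of two rank-one operators. -/
def HasPeaks (ι : Z →ₗ[ℝ] EvenBCF L W) (ε δ : ℝ) : Prop :=
  ∀ (p : L) (w : W), ‖w‖ = 1 → ∃ (Ξ : Z) (c : ℝ), ‖Ξ‖ ≤ 2 ∧ (ι Ξ).1 p = c • w ∧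
    ∀ q : L, ε ≤ signDist (p : V) q → ‖(ι Ξ).1 q‖ + δ ≤ c

theorem HasPeaks.exists_perturbation [Nontrivial W] (hι_norm : ∀ Φ : Z, ‖ι Φ‖ ≤ ‖Φ‖)
    (hpeaks : HasPeaks ι ε δ) (Θ : EvenBCF L W) (Φ : Z) (p : L) {s : ℝ} (hs : 0 ≤ s)
    (hp : ‖Θ + ι Φ‖ - s * δ / 4 < ‖(Θ + ι Φ).1 p‖) :
    ∃ Φ₁ : Z, ‖Φ₁ - Φ‖ ≤ 2 * s ∧ ∀ Φ₂ : Z, ‖Φ₂ - Φ₁‖ < s * δ / 4 →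
      ∀ q : L, ‖Θ + ι Φ₂‖ - s * δ / 4 < ‖(Θ + ι Φ₂).1 q‖ → signDist (p : V) q < ε := by
  obtain ⟨w, hw, hpw⟩ := exists_norm_one_eq_norm_smul ((Θ + ι Φ).1 p)
  obtain ⟨Ξ, c, hΞ_norm, hΞp, hΞ_far⟩ := hpeaks p w hw
  refine ⟨Φ + s • Ξ, ?_, fun Φ₂ hΦ₂ q => ?_⟩
  · rw [add_sub_cancel_left, norm_smul, Real.norm_of_nonneg hs, mul_comm]
    exact mul_le_mul_of_nonneg_right hΞ_norm hs
  · contrapose!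
    intro hfar
    have hraise : ‖(Θ + ι Φ).1 p‖ + s * c ≤ ‖(Θ + ι Φ).1 p + (s • ι Ξ).1 p‖ := calc
      ‖(Θ + ι Φ).1 p‖ + s * c ≤ ‖(‖(Θ + ι Φ).1 p‖ + s * c) • w‖ := by
        rw [norm_smul, hw, mul_one]
        exact le_abs_self _
      _ = ‖(Θ + ι Φ).1 p + (s • ι Ξ).1 p‖ := by
        rw [add_smul, ← hpw, mul_smul, ← hΞp]
        rfl
    have hq : ‖(s • ι Ξ).1 q‖ + s * δ ≤ s * c := calc
      ‖(s • ι Ξ).1 q‖ + s * δ = s * (‖(ι Ξ).1 q‖ + δ) := by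
        rw [mul_add, ← Real.norm_of_nonneg hs, ← norm_smul, Real.norm_of_nonneg hs]
        rfl
      _ ≤ s * c := mul_le_mul_of_nonneg_left (hΞ_far q hfar) hs
    have hclose : ‖Θ + ι Φ₂ - (Θ + ι Φ + s • ι Ξ)‖ < s * δ / 4 := by
      rw [add_assoc, add_sub_add_left_eq_sub, ← map_smul, ← map_add, ← map_sub]
      exact (hι_norm _).trans_lt hΦ₂
    have hpeak : ‖(Θ + ι Φ).1 p‖ + ‖(s • ι Ξ).1 q‖ + 4 * (s * δ / 4) ≤
        ‖(Θ + ι Φ).1 p + (s • ι Ξ).1 p‖ := by linarith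
    exact norm_apply_le_norm_sub_of_peak hp hpeak hclose

theorem HasPeaks.isPorousIn [Nontrivial W] (hL_ne : L.Nonempty)
    (hι_norm : ∀ Φ : Z, ‖ι Φ‖ ≤ ‖Φ‖) (hδ : 0 < δ) (hpeaks : HasPeaks ι ε δ)
    (Θ : EvenBCF L W) : IsPorousIn {Φ : Z | ¬ HasSmallSlice (Θ + ι Φ).1 ε} := by
  have := hL_ne.to_subtype
  refine ⟨min δ 1 / 16, by positivity, by linarith [min_le_right δ 1], 1, one_pos,
    fun Φ r hr _ => ?_⟩
  have hσ : 0 < r / 4 * δ / 4 := by positivity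
  obtain ⟨p, hp⟩ := (hasBasis_nearMax (Θ + ι Φ).1).neBot_iff.1 inferInstance hσ
  obtain ⟨Φ₁, hΦ₁, hslice⟩ := hpeaks.exists_perturbation hι_norm Θ Φ p (by positivity) hp
  refine ⟨Φ₁, fun Φ₂ hΦ₂ => ?_⟩
  rw [mem_ball, dist_eq_norm] at hΦ₂
  constructor
  · rw [mem_ball, dist_eq_norm]
    have hdist : ‖Φ₂ - Φ₁‖ < r / 16 := hΦ₂.trans_le (by nlinarith [min_le_right δ 1])
    linarith [norm_sub_le_norm_sub_add_norm_sub Φ₂ Φ₁ Φ]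
  · have hdist : ‖Φ₂ - Φ₁‖ < r / 4 * δ / 4 := hΦ₂.trans_le (by nlinarith [min_le_left δ 1])
    exact not_not.2 ⟨p, (hasBasis_nearMax _).eventually_iff.2 ⟨_, hσ, hslice Φ₂ hdist⟩⟩

theorem isSigmaPorousIn_not_attainsStronglyModSign [Nontrivial W] (hL_ne : L.Nonempty)
    (hL_complete : IsComplete L) (hι_norm : ∀ Φ : Z, ‖ι Φ‖ ≤ ‖Φ‖)
    (hpeaks : ∀ ε : ℝ, 0 < ε → ∃ δ : ℝ, 0 < δ ∧ HasPeaks ι ε δ) (Θ : EvenBCF L W) :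
    IsSigmaPorousIn {Φ : Z | ¬ AttainsStronglyModSign (Θ + ι Φ)} := by
  refine ⟨fun n => {Φ | ¬ HasSmallSlice (Θ + ι Φ).1 (1 / ((n : ℝ) + 1))}, fun n => ?_, ?_⟩
  · obtain ⟨δ, hδ, hpeaks_n⟩ := hpeaks _ Nat.one_div_pos_of_nat
    exact hpeaks_n.isPorousIn hL_ne hι_norm hδ Θ
  · ext Φ
    simp only [mem_ofPred_eq, mem_iUnion, ← not_forall, not_iff_not]
    refine ⟨fun h n => h.hasSmallSlice Nat.one_div_pos_of_nat, fun h => ?_⟩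
    refine attainsStronglyModSign_of_forall_hasSmallSlice hL_ne hL_complete fun ε hε => ?_
    obtain ⟨n, hn⟩ := exists_nat_one_div_lt hε
    exact (h n).imp fun _ hp => hp.mono fun _ hq => hq.trans hn

theorem dense_setOf_attainsStronglyModSign [Nontrivial W] [CompleteSpace Z] (hL_ne : L.Nonempty)
    (hL_complete : IsComplete L) (hι_norm : ∀ Φ : Z, ‖ι Φ‖ ≤ ‖Φ‖)
    (hpeaks : ∀ ε : ℝ, 0 < ε → ∃ δ : ℝ, 0 < δ ∧ HasPeaks ι ε δ) (Θ : EvenBCF L W) :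
    Dense {Φ : Z | AttainsStronglyModSign (Θ + ι Φ)} := by
  simpa only [compl_ofPred, not_not] using
    (isSigmaPorousIn_not_attainsStronglyModSign hL_ne hL_complete hι_norm hpeaks Θ).dense_compl

theorem HasPeaks.exists_attaining_perturbation [Nontrivial W] (hι_norm : ∀ Φ : Z, ‖ι Φ‖ ≤ ‖Φ‖)
    (hδ : 0 < δ) (hpeaks : HasPeaks ι ε δ) {Θ : EvenBCF L W}
    (hdense : Dense {Φ : Z | AttainsStronglyModSign (Θ + ι Φ)}) (Φ : Z) (p : L) {s : ℝ}
    (hs : 0 < s) (hp : ‖Θ + ι Φ‖ - s * δ / 4 < ‖(Θ + ι Φ).1 p‖) :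
    ∃ (Ψ : Z) (q : L), ‖Ψ - Φ‖ < 3 * s ∧ ‖(Θ + ι Ψ).1 q‖ = ‖Θ + ι Ψ‖ ∧
      signDist (p : V) q < ε := by
  have hσ : 0 < s * δ / 4 := by positivity
  obtain ⟨Φ₁, hΦ₁, hslice⟩ := hpeaks.exists_perturbation hι_norm Θ Φ p hs.le hp
  obtain ⟨Ψ, hΨ, hΨ_dist⟩ := hdense.exists_dist_lt Φ₁ (lt_min hs hσ)
  rw [dist_comm, dist_eq_norm] at hΨ_dist
  obtain ⟨q, hq, -⟩ := attainsStronglyModSign_iff.1 hΨ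
  refine ⟨Ψ, q, ?_, hq, hslice Ψ (hΨ_dist.trans_le (min_le_right _ _)) q ?_⟩
  · linarith [norm_sub_le_norm_sub_add_norm_sub Ψ Φ₁ Φ, min_le_left s (s * δ / 4)]
  · exact (sub_lt_self _ hσ).trans_eq hq.symm

theorem exists_norm_sub_lt_forall_apply_eq (hL_symm : ∀ p ∈ L, -p ∈ L) {p q : L}
    (hpq : signDist (p : V) q < ε) :
    ∃ q' : L, ‖(p : V) - q'‖ < ε ∧ ∀ Φ : EvenBCF L W, Φ.1 q' = Φ.1 q := by
  rcases signDist_lt_iff.1 hpq with hsub | hadd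
  · exact ⟨q, hsub, fun _ => rfl⟩
  · exact ⟨⟨-q, hL_symm q q.2⟩, by rwa [sub_neg_eq_add], fun Φ => Φ.2 _ _ rfl⟩

theorem bishopPhelpsBollobas_of_hasPeaks [Nontrivial W] (hL_symm : ∀ p ∈ L, -p ∈ L)
    (hι_norm : ∀ Φ : Z, ‖ι Φ‖ ≤ ‖Φ‖) (hdense : Dense {Φ : Z | AttainsStronglyModSign (ι Φ)})
    (hε : 0 < ε) (hδ : 0 < δ) (hpeaks : HasPeaks ι ε δ) :
    ∃ η : ℝ, 0 < η ∧ ∀ (Φ : Z) (p : L), ‖ι Φ‖ = 1 → 1 - η < ‖(ι Φ).1 p‖ →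
      ∃ (Ψ : Z) (q : L), ‖ι Ψ‖ = 1 ∧ ‖(ι Ψ).1 q‖ = 1 ∧ ‖(p : V) - q‖ < ε ∧
        ‖ι Ψ - ι Φ‖ < ε := by
  have hs : 0 < min ε 1 / 6 := by positivity
  refine ⟨min ε 1 / 6 * δ / 4, by positivity, fun Φ p hΦ hp => ?_⟩
  obtain ⟨Ψ, q, hΨΦ, hq, hpq⟩ := hpeaks.exists_attaining_perturbation hι_norm hδ (Θ := 0)
    (by simpa only [zero_add] using hdense) Φ p hs (by rwa [zero_add, hΦ])
  obtain ⟨q', hpq', hqq'⟩ := exists_norm_sub_lt_forall_apply_eq (W := W) hL_symm hpq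
  rw [zero_add, ← hqq'] at hq
  have hclose : ‖ι Ψ - ι Φ‖ < min ε 1 / 2 := by
    rw [← map_sub]
    linarith [hι_norm (Ψ - Φ)]
  have hne : ι Ψ ≠ 0 := by
    intro h
    rw [h, zero_sub, norm_neg, hΦ] at hclose
    linarith [min_le_right ε 1]
  have hnormalize : ι (‖ι Ψ‖⁻¹ • Ψ) = NormedSpace.normalize (ι Ψ) := map_smul ι _ Ψ
  refine ⟨‖ι Ψ‖⁻¹ • Ψ, q', ?_, ?_, hpq', ?_⟩ <;> rw [hnormalize]
  · exact NormedSpace.norm_normalize hne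
  · calc
      ‖(NormedSpace.normalize (ι Ψ)).1 q'‖ = ‖‖ι Ψ‖⁻¹ • (ι Ψ).1 q'‖ := rfl
      _ = 1 := by
        rw [norm_smul, norm_inv, norm_norm, hq, inv_mul_cancel₀ (norm_ne_zero_iff.2 hne)]
  · linarith [norm_normalize_sub_le hΦ (ι Ψ), min_le_left ε 1]

end Peaks

section PeakOperators

variable {X Y : Type*} [NormedAddCommGroup X] [NormedSpace ℝ X]
  [NormedAddCommGroup Y] [NormedSpace ℝ Y]

/-- The operator `f ⊗ e + g ⊗ b : x ↦ f(x) e + g(x) b`, of rank at most two. -/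
noncomputable def rankTwo (f : StrongDual ℝ X) (e : Y) (g : StrongDual ℝ X) (b : Y) : X →L[ℝ] Y :=
  f.smulRight e + g.smulRight b

variable {f g : StrongDual ℝ X} {e b : Y}

theorem apply_rankTwo (h : StrongDual ℝ Y) (x : X) :
    h (rankTwo f e g b x) = f x * h e + g x * h b := by
  simp [rankTwo]

theorem finiteDimensional_range_rankTwo :
    FiniteDimensional ℝ (rankTwo f e g b : X →ₗ[ℝ] Y).range := by
  have : FiniteDimensional ℝ (Submodule.span ℝ {e, b}) := .span_of_finite ℝ (toFinite _)
  refine Submodule.finiteDimensional_of_le (S₂ := Submodule.span ℝ {e, b}) ?_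
  rintro _ ⟨x, rfl⟩
  exact Submodule.mem_span_pair.2 ⟨f x, g x, rfl⟩

theorem norm_rankTwo_le (hf : ‖f‖ ≤ 1) (he : ‖e‖ ≤ 1) (hg : ‖g‖ ≤ 1) (hb : ‖b‖ ≤ 1) :
    ‖rankTwo f e g b‖ ≤ 2 := calc
  ‖f.smulRight e + g.smulRight b‖ ≤ ‖f‖ * ‖e‖ + ‖g‖ * ‖b‖ := by
    simpa only [ContinuousLinearMap.norm_smulRight_apply] using
      norm_add_le (f.smulRight e) (g.smulRight b)
  _ ≤ 1 + 1 := add_le_add (mul_le_one₀ hf (norm_nonneg e) he) (mul_le_one₀ hg (norm_nonneg b) hb)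
  _ = 2 := one_add_one_eq_two

theorem abs_apply_rankTwo_le {h : StrongDual ℝ Y} {x : X} (hh : ‖h‖ ≤ 1) (hx : ‖x‖ ≤ 1)
    (he : ‖e‖ ≤ 1) (hg : ‖g‖ ≤ 1) : |h (rankTwo f e g b x)| ≤ |f x| + |h b| := calc
  |h (rankTwo f e g b x)| ≤ |f x| * |h e| + |g x| * |h b| := by
    rw [apply_rankTwo, ← abs_mul, ← abs_mul]
    exact abs_add_le _ _
  _ ≤ |f x| + |h b| :=
    add_le_add (mul_le_of_le_one_right (abs_nonneg _) (abs_apply_le_one hh he))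
      (mul_le_of_le_one_left (abs_nonneg _) (abs_apply_le_one hg hx))

theorem HasPropertyP.exists_peak_operator {L : Set (ProdDual X Y)} (hL_P : HasPropertyP L)
    (hL_sphere : ∀ p ∈ L, ‖p.fst‖ = 1 ∧ ‖p.snd‖ = 1) {ε : ℝ} (hε : 0 < ε) :
    ∃ δ : ℝ, 0 < δ ∧ ∀ p ∈ L, ∃ T : X →L[ℝ] Y,
      FiniteDimensional ℝ (T : X →ₗ[ℝ] Y).range ∧ ‖T‖ ≤ 2 ∧
        ∀ q ∈ L, ε ≤ signDist p q → |q.snd (T q.fst)| + δ ≤ p.snd (T p.fst) := by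
  obtain ⟨ε₀, hε₀, hP⟩ := hL_P
  obtain ⟨ε₁, hε₁, hε₁_lt⟩ := exists_between (lt_min hε hε₀)
  obtain ⟨δ, hδ, hP⟩ := hP ε₁ hε₁ (hε₁_lt.trans_le (min_le_right _ _))
  refine ⟨δ / 2, half_pos hδ, fun p hp => ?_⟩
  obtain ⟨f, b, hf, hb, hfb⟩ := hP p hp
  obtain ⟨hp_fst, hp_snd⟩ := hL_sphere p hp
  obtain ⟨g, hg, hgp⟩ : ∃ g : StrongDual ℝ X, ‖g‖ = 1 ∧ g p.fst = ‖p.fst‖ :=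
    exists_dual_vector ℝ p.fst (hp_fst.trans_ne one_ne_zero)
  obtain ⟨e, he, hpe⟩ : ∃ e : Y, ‖e‖ ≤ 1 ∧ 1 - δ / 2 < p.snd e :=
    exists_norm_le_one_lt_apply (by linarith)
  refine ⟨rankTwo f e g b, finiteDimensional_range_rankTwo, norm_rankTwo_le hf he hg.le hb,
    fun q hq hpq => ?_⟩
  obtain ⟨hq_fst, hq_snd⟩ := hL_sphere q hq
  have hfp : f p.fst ≤ 1 := (abs_le.1 (abs_apply_le_one hf hp_fst.le)).2
  have hpe_le : p.snd e ≤ 1 := (abs_le.1 (abs_apply_le_one hp_snd.le he)).2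
  calc
    |q.snd (rankTwo f e g b q.fst)| + δ / 2 ≤ |f q.fst| + |q.snd b| + δ / 2 :=
      add_le_add_left (abs_apply_rankTwo_le hq_snd.le hq_fst.le he hg.le) _
    _ ≤ f p.fst + p.snd b - δ / 2 := by
      linarith [hfb q hq ((hε₁_lt.trans_le (min_le_left _ _)).le.trans hpq)]
    _ ≤ f p.fst * p.snd e + p.snd b := by
      linarith [mul_le_of_le_one_left (sub_nonneg.2 hpe_le) hfp]
    _ = p.snd (rankTwo f e g b p.fst) := by rw [apply_rankTwo, hgp, hp_fst, one_mul]

theorem HasPropertyP.exists_hasPeaks {L : Set (ProdDual X Y)} (hL_P : HasPropertyP L)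
    (hL_sphere : ∀ p ∈ L, ‖p.fst‖ = 1 ∧ ‖p.snd‖ = 1)
    {W : Type*} [NormedAddCommGroup W] [NormedSpace ℝ W]
    {Z : Type*} [SeminormedAddCommGroup Z] [NormedSpace ℝ Z] {ι : Z →ₗ[ℝ] EvenBCF L W}
    (hι_tensor : ∀ T : X →L[ℝ] Y, FiniteDimensional ℝ (T : X →ₗ[ℝ] Y).range → ∀ w : W,
      ∃ Φ : Z, (∀ p : L, (ι Φ).1 p = opTensor T w p) ∧ ‖Φ‖ ≤ ‖T‖ * ‖w‖)
    {ε : ℝ} (hε : 0 < ε) : ∃ δ : ℝ, 0 < δ ∧ HasPeaks ι ε δ := by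
  obtain ⟨δ, hδ, hT⟩ := hL_P.exists_peak_operator hL_sphere hε
  refine ⟨δ, hδ, fun p w hw => ?_⟩
  obtain ⟨T, hT_fin, hT_norm, hT_peak⟩ := hT p p.2
  obtain ⟨Ξ, hΞ, hΞ_norm⟩ := hι_tensor T hT_fin w
  rw [hw, mul_one] at hΞ_norm
  refine ⟨Ξ, p.1.snd (T p.1.fst), hΞ_norm.trans hT_norm, hΞ p, fun q hpq => ?_⟩
  rw [hΞ q, opTensor, norm_smul, hw, mul_one]
  exact hT_peak q q.2 hpq

end PeakOperators

theorem theorem3p9_general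
    {X Y W Z : Type*}
    [NormedAddCommGroup X] [NormedSpace ℝ X]
    [NormedAddCommGroup Y] [NormedSpace ℝ Y]
    [NormedAddCommGroup W] [NormedSpace ℝ W] [Nontrivial W]
    [SeminormedAddCommGroup Z] [NormedSpace ℝ Z] [CompleteSpace Z]
    (L : Set (ProdDual X Y))
    (hL_ne : L.Nonempty)
    (hL_symm : ∀ p ∈ L, -p ∈ L)
    (hL_complete : IsComplete L)
    (hL_sphere : ∀ p ∈ L, ‖p.fst‖ = 1 ∧ ‖p.snd‖ = 1)
    (hL_P : HasPropertyP L)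
    (ι : Z →ₗ[ℝ] EvenBCF L W)
    (hι_norm : ∀ Φ : Z, ‖ι Φ‖ ≤ ‖Φ‖)
    (hι_tensor : ∀ T : X →L[ℝ] Y, FiniteDimensional ℝ (T : X →ₗ[ℝ] Y).range → ∀ w : W,
      ∃ Φ : Z, (∀ p : L, (ι Φ).1 p = opTensor T w p) ∧ ‖Φ‖ ≤ ‖T‖ * ‖w‖) :
    (∀ Θ : EvenBCF L W,
      ∃ A : Set Z, IsSigmaPorousIn A ∧ {Φ : Z | AttainsStronglyModSign (Θ + ι Φ)} = Aᶜ) ∧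
    (∀ ε : ℝ, 0 < ε → ∃ η : ℝ, 0 < η ∧
      ∀ (Φ : Z) (p : L), ‖ι Φ‖ = 1 → 1 - η < ‖(ι Φ).1 p‖ →
        ∃ (Ψ : Z) (q : L), ‖ι Ψ‖ = 1 ∧ ‖(ι Ψ).1 q‖ = 1 ∧
          ‖p.1.fst - q.1.fst‖ + ‖p.1.snd - q.1.snd‖ < ε ∧ ‖ι Ψ - ι Φ‖ < ε) := by
  have hpeaks : ∀ ε : ℝ, 0 < ε → ∃ δ : ℝ, 0 < δ ∧ HasPeaks ι ε δ := fun ε hε =>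
    hL_P.exists_hasPeaks hL_sphere hι_tensor hε
  have hnorm : ∀ p q : ProdDual X Y, ‖p.fst - q.fst‖ + ‖p.snd - q.snd‖ = ‖p - q‖ := fun p q =>
    (WithLp.prod_norm_eq_of_L1 (p - q)).symm
  simp only [hnorm]
  refine ⟨fun Θ => ⟨_, isSigmaPorousIn_not_attainsStronglyModSign hL_ne hL_complete hι_norm
    hpeaks Θ, (compl_compl _).symm⟩, fun ε hε => ?_⟩
  have hdense : Dense {Φ : Z | AttainsStronglyModSign (ι Φ)} := by
    simpa only [zero_add] using
      dense_setOf_attainsStronglyModSign hL_ne hL_complete hι_norm hpeaks 0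
  obtain ⟨δ, hδ, hpeaks_ε⟩ := hpeaks ε hε
  exact bishopPhelpsBollobas_of_hasPeaks hL_symm hι_norm hdense hε hδ hpeaks_ε

/-- The Banach space `Z` included in the space of bounded continuous even maps is given as a
Banach space with an injective linear map `ι` into that space. -/
theorem theorem3p9
    {X Y W Z : Type*}
    [NormedAddCommGroup X] [NormedSpace ℝ X] [CompleteSpace X]
    [NormedAddCommGroup Y] [NormedSpace ℝ Y] [CompleteSpace Y]
    [NormedAddCommGroup W] [NormedSpace ℝ W] [CompleteSpace W] [Nontrivial W]
    [NormedAddCommGroup Z] [NormedSpace ℝ Z] [CompleteSpace Z]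
    (L : Set (ProdDual X Y))
    (hL_ne : L.Nonempty)
    (hL_symm : ∀ p ∈ L, -p ∈ L)
    (hL_closed : IsClosed L)
    (hL_sphere : ∀ p ∈ L, ‖p.fst‖ = 1 ∧ ‖p.snd‖ = 1)
    (hL_P : HasPropertyP L)
    (ι : Z →ₗ[ℝ] EvenBCF L W)
    (hι_inj : Function.Injective ι)
    (hι_norm : ∀ Φ : Z, ‖ι Φ‖ ≤ ‖Φ‖)
    (hι_tensor : ∀ T : X →L[ℝ] Y, FiniteDimensional ℝ (T : X →ₗ[ℝ] Y).range → ∀ w : W,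
      ∃ Φ : Z, (∀ p : L, (ι Φ).1 p = opTensor T w p) ∧ ‖Φ‖ ≤ ‖T‖ * ‖w‖) :
    (∀ Θ : EvenBCF L W,
      ∃ A : Set Z, IsSigmaPorousIn A ∧ {Φ : Z | AttainsStronglyModSign (Θ + ι Φ)} = Aᶜ) ∧
    (∀ ε : ℝ, 0 < ε → ∃ η : ℝ, 0 < η ∧
      ∀ (Φ : Z) (p : L), ‖ι Φ‖ = 1 → 1 - η < ‖(ι Φ).1 p‖ →
        ∃ (Ψ : Z) (q : L), ‖ι Ψ‖ = 1 ∧ ‖(ι Ψ).1 q‖ = 1 ∧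
          ‖p.1.fst - q.1.fst‖ + ‖p.1.snd - q.1.snd‖ < ε ∧ ‖ι Ψ - ι Φ‖ < ε) :=
  theorem3p9_general L hL_ne hL_symm hL_closed.isComplete hL_sphere hL_P ι hι_norm hι_tensor
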